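/- Let $X$ be a real Banach space with dual $X^*$ and closed unit ball $\bar{\mathbf B}$; products of Banach spaces carry the maximum norm. For a closed set $S\subset X$ and $x_0\in S$: - a bounded set $D\subset X$ is a *uniform tangent set* to $S$ at $x_0$ if for each $\varepsilon>0$ there is $\delta>0$ such that for each $v\in D$ and each $x\in S\cap(x_0+\delta\bar{\mathbf B})$ there is $\lambda>0$ with $S\cap(x+t(v+\varepsilon\bar{\mathbf B}))\neq\emptyset$ for all $t\in[0,\lambda]$; - the *Clarke tangent cone* $\hat T_S(x_0)$ is the set of all $v\in X$ such that for each $\varepsilon>0$ there are $\delta>0$ and $\lambda>0$ with $S\cap(x+t(v+\varepsilon\bar{\mathbf B}))\neq\emptyset$ for all $x\in S\cap(x_0+\delta\bar{\mathbf B})$ and all $t\in[0,\lambda]$; - the *Clarke normal cone* is $N_S(x_0)=\{x^*\in X^* : \langle x^*,v\rangle\le 0 \text{ for all } v\in\hat T_S(x_0)\}$. Closed sets $A,B\subset X$ are *strongly tangentially transversal* at $x_0\in A\cap B$ if there are a uniform tangent set $D_A$ to $A$ at $x_0$, a uniform tangent set $D_B$ to $B$ at $x_0$ and $\rho>0$ such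 that $\rho\bar{\mathbf B}\subset\overline{\mathrm{co}}\,(D_A-D_B)$. The same notions are used in $X\times\mathbb R$ and $X\times\mathbb R\times\mathbb R$. For $f:X\to\mathbb R\cup\{+\infty\}$ with epigraph $\mathrm{epi} f=\{(x,r)\in X\times\mathbb R : r\ge f(x)\}$ and a point $x_0$ with $f(x_0)<+\infty$, the *Clarke subdifferential* is $\partial_C f(x_0)=\{x^*\in X^* : (x^*,-1)\in N_{\mathrm{epi} f}(x_0,f(x_0))\}$. **Corollary.** (a) Let $A,B\subset X$ be closed, $x_0\in A\cap B$, and let $A$ and $B$ be strongly tangentially transversal at $x_0$. Then (i) $\hat T_A(x_0)\cap\hat T_B(x_0)\subset\hat T_{A\cap B}(x_0)$; (ii) $N_{A\cap B}(x_0)\subset N_A(x_0)+N_B(x_0)$. (b) Let $f_1,f_2:X\to\mathbb R\cup\{+\infty\}$ be proper and lower semicontinuous and let $x_0\in\mathrm{dom} f_1\cap\mathrm{dom} f_2$. If the closed sets $$C_1=\{(x,r_1,r_2)\in X\times\mathbb R\times\mathbb R : r_1\ge f_1(x)\},\qquad C_2=\{(x,r_1,r_2)\in X\times\mathbb R\times\mathbb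 R : r_2\ge f_2(x)\}$$ are strongly tangentially transversal at $(x_0,f_1(x_0),f_2(x_0))$, then $$\partial_C(f_1+f_2)(x_0)\subset\partial_C f_1(x_0)+\partial_C f_2(x_0).$$ -/

import Mathlib

open Set Metric
open scoped Pointwise

/-- `D` is a uniform tangent set to `S` at `x₀` (used for closed `S` and `x₀ ∈ S`): `D` is bounded
and for every `ε > 0` there is `δ > 0` such that for all `v ∈ D` and all `x ∈ S` with
`‖x - x₀‖ ≤ δ` there is `lam > 0` such that `S` meets `x + t (v + ε B)` for each `t ∈ [0, lam]`,
`B` being the closed unit ball. The number `lam` may depend on `v` and `x`. -/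
def IsUniformTangentSet {X : Type*} [NormedAddCommGroup X] [NormedSpace ℝ X]
    (S : Set X) (x₀ : X) (D : Set X) : Prop :=
  Bornology.IsBounded D ∧
    ∀ ε : ℝ, 0 < ε → ∃ δ : ℝ, 0 < δ ∧ ∀ v ∈ D, ∀ x ∈ S ∩ closedBall x₀ δ,
      ∃ lam : ℝ, 0 < lam ∧ ∀ t ∈ Icc (0 : ℝ) lam, ∃ w ∈ closedBall v ε, x + t • w ∈ S

/-- The Clarke tangent cone to `S` at `x₀`. -/
def clarkeTangentCone {X : Type*} [NormedAddCommGroup X] [NormedSpace ℝ X]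
    (S : Set X) (x₀ : X) : Set X :=
  {v | ∀ ε : ℝ, 0 < ε → ∃ δ : ℝ, 0 < δ ∧ ∃ lam : ℝ, 0 < lam ∧ ∀ x ∈ S ∩ closedBall x₀ δ,
      ∀ t ∈ Icc (0 : ℝ) lam, ∃ w ∈ closedBall v ε, x + t • w ∈ S}

/-- The Clarke normal cone to `S` at `x₀`: the polar of the Clarke tangent cone. -/
def clarkeNormalCone {X : Type*} [NormedAddCommGroup X] [NormedSpace ℝ X]
    (S : Set X) (x₀ : X) : Set (X →L[ℝ] ℝ) :=
  {φ | ∀ v ∈ clarkeTangentCone S x₀, φ v ≤ 0}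

/-- Strong tangential transversality of `A` and `B` at `x₀`
(used for closed `A`, `B` and `x₀ ∈ A ∩ B`). -/
def StronglyTangentiallyTransversal {X : Type*} [NormedAddCommGroup X] [NormedSpace ℝ X]
    (A B : Set X) (x₀ : X) : Prop :=
  ∃ DA DB : Set X, IsUniformTangentSet A x₀ DA ∧ IsUniformTangentSet B x₀ DB ∧
    ∃ ρ : ℝ, 0 < ρ ∧ closedBall (0 : X) ρ ⊆ closure (convexHull ℝ (DA - DB))

/-- The epigraph of an extended real valued function, a subset of `X × ℝ`. -/
def epigraph {X : Type*} (f : X → EReal) : Set (X × ℝ) :=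
  {p | f p.1 ≤ (p.2 : EReal)}

/-- The Clarke subdifferential of `f` at `x₀`: the set of all `φ` in the dual of `X` such that
`(φ, -1)`, i.e. the functional `(v, r) ↦ φ v - r`, belongs to the Clarke normal cone to the epigraph
of `f` at `(x₀, f x₀)`. It is empty where `f` is not finite. -/
def clarkeSubdifferential {X : Type*} [NormedAddCommGroup X] [NormedSpace ℝ X]
    (f : X → EReal) (x₀ : X) : Set (X →L[ℝ] ℝ) :=
  {φ | f x₀ ≠ ⊥ ∧ f x₀ ≠ ⊤ ∧
    φ.comp (ContinuousLinearMap.fst ℝ X ℝ) - ContinuousLinearMap.snd ℝ X ℝ ∈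
      clarkeNormalCone (epigraph f) (x₀, (f x₀).toReal)}

/-!
Two facts carry everything: a tangency statement that is uniform over convex hulls, and a Newton
iteration.

*Uniform tangency.* In the definition of a uniform tangent set `D` the admissible step length may
depend on the point and on the direction. For a closed subset `S` of a Banach space it need not:
short steps can be concatenated, limits of concatenated steps stay in `S`, and a maximal
concatenation reaches the full length as long as it stays in the ball around `x₀` where steps are
available (`exists_step_of_forall_exists_step`). Once the step length is uniform, moving first along
one direction and then along another shows that convex combinations of elements of `D` are admissible
directions too (`exists_step_of_mem_convexHull`). In particular `convexHull ℝ D` lies in the Clarke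
tangent cone.

*Newton iteration.* Suppose that `closedBall 0 ρ ⊆ closure (CA - CB)` for bounded sets `CA`, `CB` of
directions along which one can move inside `A` and inside `B`. Given `a ∈ A` and `b ∈ B`, choose
`va ∈ CA`, `vb ∈ CB` such that `va - vb` almost points from `a` to `b`; moving `a` along `va` and `b`
along `vb` halves the gap `‖a - b‖`, at a cost proportional to it. The iterates converge to a common
point of `A` and `B` at distance at most `K * ‖a - b‖` from `a` (`exists_mem_inter_of_step`).

The lemma is used twice. For `A` and `B` themselves it yields a linear estimate for the distance to
the intersection, and the inclusion of the tangent cones follows: for `v` tangent to both sets,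
`x + t • v` is within `o(t)` of `A` and of `B`, hence of `A ∩ B`. Applied to the tangent cones `P` of
`A` and `Q` of `B`, it shows that every `u` is a difference `a - b` with `a ∈ P`, `b ∈ Q` and
`‖b‖ ≤ K * ‖u‖`. Under this condition the polar of `P ∩ Q` is the sum of the polars, by the
Hahn-Banach theorem for the sublinear functional `u ↦ inf {-φ b | u = a - b, a ∈ P, b ∈ Q}`
(`PointedCone.exists_add_eq_of_forall_nonpos`); this is the inclusion of the normal cones.

For the sum rule, the normal cone inclusion is applied to the epigraphs of `f₁` and `f₂` lifted to
`X × ℝ × ℝ`. A vector `(v, r₁, r₂)` tangent to the intersection of the lifts gives the vector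
`(v, r₁ + r₂)` tangent to the epigraph of `f₁ + f₂`, so a subgradient `φ` of the sum gives a normal
`(φ, -1, -1)`. Each lift is invariant under translation in one real variable, so the corresponding
component of its normals vanishes, and the two summands of `(φ, -1, -1)` are `(φ₁, -1, 0)` and
`(φ₂, 0, -1)`.
-/

/-! ### A maximality principle for monotone functions -/

/-- An order-theoretic maximality principle of Brezis-Browder type: if increasing sequences have upper
bounds, then a bounded monotone real function is eventually constant above every point. -/
lemma exists_ge_forall_ge_le {α : Type*} [Preorder α] {s : α → ℝ} (hs : Monotone s) {c : ℝ}
    (hc : ∀ p, s p ≤ c) (hseq : ∀ u : ℕ → α, Monotone u → BddAbove (range u)) (p : α) :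
    ∃ q, p ≤ q ∧ ∀ q', q ≤ q' → s q' ≤ s q := by
  have hbdd : ∀ p, BddAbove (s '' Ici p) := fun p => ⟨c, by rintro _ ⟨q, -, rfl⟩; exact hc q⟩
  -- Each `p` has a successor `q` which gains at least half of what can be gained above `p`.
  have hnext : ∀ p, ∃ q, p ≤ q ∧ ∀ q', p ≤ q' → s q' ≤ s q + (s q - s p) := by
    intro p
    by_cases h : ∃ q, p ≤ q ∧ s p < s q
    · obtain ⟨q₀, hpq₀, hlt⟩ := h
      have h0 : s q₀ ≤ sSup (s '' Ici p) := le_csSup (hbdd p) ⟨q₀, hpq₀, rfl⟩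
      obtain ⟨_, ⟨q, hq, rfl⟩, hlt'⟩ := exists_lt_of_lt_csSup (s := s '' Ici p)
        ⟨_, q₀, hpq₀, rfl⟩ (show (s p + sSup (s '' Ici p)) / 2 < sSup (s '' Ici p) by linarith)
      refine ⟨q, hq, fun q' hq' => ?_⟩
      have := le_csSup (hbdd p) (mem_image_of_mem s (show q' ∈ Ici p from hq'))
      linarith
    · push Not at h
      exact ⟨p, le_rfl, fun q' hq' => by linarith [h q' hq']⟩
  choose nx hnx hnx' using hnext
  let u : ℕ → α := fun n => nx^[n] p
  have hu : ∀ n, u (n + 1) = nx (u n) := fun n => Function.iterate_succ_apply' nx n p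
  have humono : Monotone u := monotone_nat_of_le_succ fun n => (hu n).symm ▸ hnx _
  obtain ⟨q, hq⟩ := hseq u humono
  have hq : ∀ n, u n ≤ q := fun n => hq ⟨n, rfl⟩
  refine ⟨q, hq 0, fun q' hq' => ?_⟩
  have hlim := tendsto_atTop_ciSup (hs.comp humono) ⟨c, by rintro _ ⟨n, rfl⟩; exact hc _⟩
  have hlim1 := hlim.comp (Filter.tendsto_add_atTop_nat 1)
  have h1 : s q' ≤ _ := ge_of_tendsto' (hlim1.add (hlim1.sub hlim)) fun n => by
    have := hnx' (u n) q' ((hq n).trans hq')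
    rw [← hu] at this
    exact this
  have h2 := le_of_tendsto' hlim fun n => hs (hq n)
  linarith

/-! ### Tangent steps of uniform length -/

section Steps

variable {X : Type*} [NormedAddCommGroup X] [NormedSpace ℝ X]

lemma exists_mem_closedBall_add_smul_mem {S : Set X} {x y v : X} {t ε : ℝ} (ht : 0 ≤ t)
    (hε : 0 ≤ ε) (hy : y ∈ S) (h : ‖y - x - t • v‖ ≤ ε * t) :
    ∃ w ∈ closedBall v ε, x + t • w ∈ S := by
  rcases ht.eq_or_lt with rfl | ht
  · refine ⟨v, mem_closedBall_self hε, ?_⟩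
    have : y = x := by simpa [sub_eq_zero] using h
    simpa [← this] using hy
  · refine ⟨t⁻¹ • (y - x), ?_, ?_⟩
    · have : t⁻¹ • (y - x) - v = t⁻¹ • (y - x - t • v) := by
        rw [smul_sub _ _ (t • v), inv_smul_smul₀ ht.ne']
      rw [mem_closedBall, dist_eq_norm, this, norm_smul, norm_inv, Real.norm_of_nonneg ht.le,
        inv_mul_le_iff₀ ht]
      linarith
    · rw [smul_inv_smul₀ ht.ne']
      simpa using hy

/-- If every point of `S` near `x₀` admits some positive step length in the direction `v`, then every
step that cannot leave the ball `closedBall x₀ δ` is admissible: the step length no longer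
depends on the point, and on the direction only through its norm. -/
lemma exists_step_of_forall_exists_step [CompleteSpace X] {S : Set X} (hS : IsClosed S)
    {x₀ v : X} {ε δ : ℝ} (hε : 0 ≤ ε)
    (hloc : ∀ x ∈ S ∩ closedBall x₀ δ, ∃ lam : ℝ, 0 < lam ∧ ∀ t ∈ Icc (0 : ℝ) lam,
      ∃ w ∈ closedBall v ε, x + t • w ∈ S)
    {x : X} (hx : x ∈ S) {T : ℝ} (hT : 0 ≤ T) (hxT : ‖x - x₀‖ + T * (‖v‖ + ε) ≤ δ) :
    ∃ w ∈ closedBall v ε, x + T • w ∈ S := by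
  -- `r p q` says that `q.2` is reached from `p.2` by a step of length `q.1 - p.1`.
  let r : ℝ × X → ℝ × X → Prop := fun p q =>
    p.1 ≤ q.1 ∧ ‖q.2 - p.2 - (q.1 - p.1) • v‖ ≤ ε * (q.1 - p.1)
  have hrtrans : ∀ p q o, r p q → r q o → r p o := by
    rintro p q o ⟨h1, h2⟩ ⟨h3, h4⟩
    refine ⟨h1.trans h3, ?_⟩
    have : o.2 - p.2 - (o.1 - p.1) • v
        = (o.2 - q.2 - (o.1 - q.1) • v) + (q.2 - p.2 - (q.1 - p.1) • v) := by module
    rw [this]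
    refine (norm_add_le _ _).trans ?_
    linarith
  let P := {p : ℝ × X // p.2 ∈ S ∧ p.1 ≤ T ∧ r (0, x) p}
  let : Preorder P :=
    { le := fun p q => r p.1 q.1
      le_refl := fun p => by simp [r]
      le_trans := fun p q o => hrtrans p.1 q.1 o.1 }
  have hseq : ∀ u : ℕ → P, Monotone u → BddAbove (range u) := by
    intro u hu
    have hmono : Monotone fun n => (u n).1.1 := fun m n h => (hu h).1
    have hlim := tendsto_atTop_ciSup hmono ⟨T, by rintro _ ⟨n, rfl⟩; exact (u n).2.2.1⟩
    have hdist : ∀ m n, m ≤ n →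
        dist (u n).1.2 (u m).1.2 ≤ (‖v‖ + ε) * dist (u n).1.1 (u m).1.1 := by
      intro m n h
      obtain ⟨h1, h2⟩ := hu h
      rw [dist_eq_norm, Real.dist_eq, abs_of_nonneg (sub_nonneg.2 h1)]
      have h3 := norm_add_le ((u n).1.2 - (u m).1.2 - ((u n).1.1 - (u m).1.1) • v)
        (((u n).1.1 - (u m).1.1) • v)
      rw [sub_add_cancel, norm_smul, Real.norm_of_nonneg (sub_nonneg.2 h1)] at h3
      linarith
    have hC : CauchySeq fun n => (u n).1.2 := by
      rw [Metric.cauchySeq_iff']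
      intro η hη
      have hpos : 0 < ‖v‖ + ε + 1 := by positivity
      obtain ⟨N, hN⟩ := Metric.cauchySeq_iff'.1 hlim.cauchySeq (η / (‖v‖ + ε + 1)) (by positivity)
      refine ⟨N, fun n hn => (hdist N n hn).trans_lt ?_⟩
      have h1 := hN n hn
      rw [lt_div_iff₀ hpos] at h1
      have : 0 ≤ dist (u n).1.1 (u N).1.1 := dist_nonneg
      linarith
    obtain ⟨y, hy⟩ := cauchySeq_tendsto_of_complete hC
    have hr : ∀ p : ℝ × X, (∀ᶠ n in Filter.atTop, r p (u n).1) → r p (⨆ n, (u n).1.1, y) := by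
      intro p hp
      refine ⟨ge_of_tendsto hlim (hp.mono fun n h => h.1), ?_⟩
      refine le_of_tendsto_of_tendsto
        ((hy.sub_const p.2).sub ((hlim.sub_const p.1).smul_const v)).norm
        ((hlim.sub_const p.1).const_mul ε) (hp.mono fun n h => h.2)
    refine ⟨⟨(⨆ n, (u n).1.1, y), hS.mem_of_tendsto hy (.of_forall fun n => (u n).2.1),
      le_of_tendsto' hlim fun n => (u n).2.2.1, hr _ (.of_forall fun n => (u n).2.2.2)⟩, ?_⟩
    rintro _ ⟨m, rfl⟩
    exact hr _ ((Filter.eventually_ge_atTop m).mono fun n hn => hu hn)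
  obtain ⟨⟨⟨s, y⟩, hyS, hsT, hs0, hsy⟩, -, hmax⟩ := exists_ge_forall_ge_le (α := P)
    (s := fun p => p.1.1) (fun p q (h : r p.1 q.1) => h.1) (fun p => p.2.2.1) hseq
    ⟨(0, x), hx, hT, by simp [r]⟩
  simp only [sub_zero] at hyS hsT hs0 hsy
  -- A maximal concatenation of length `s < T` could be prolonged by a short step.
  have hsT' : T ≤ s := by
    by_contra! hlt
    have hyball : y ∈ closedBall x₀ δ := by
      rw [mem_closedBall, dist_eq_norm]
      have h3 := norm_add₃_le (a := y - x - s • v) (b := s • v) (c := x - x₀)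
      rw [norm_smul, Real.norm_of_nonneg hs0,
        show y - x - s • v + s • v + (x - x₀) = y - x₀ by abel] at h3
      have : s * (‖v‖ + ε) ≤ T * (‖v‖ + ε) := by gcongr
      linarith
    obtain ⟨lam, hlam, hstep⟩ := hloc y ⟨hyS, hyball⟩
    obtain ⟨w, hw, hwS⟩ := hstep (min lam (T - s))
      ⟨le_min hlam.le (by linarith), min_le_left _ _⟩
    have hτ : 0 < min lam (T - s) := lt_min hlam (by linarith)
    have hτT : min lam (T - s) ≤ T - s := min_le_right _ _
    set τ := min lam (T - s)
    have hrel : r (s, y) (s + τ, y + τ • w) := by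
      refine ⟨by simp [hτ.le], ?_⟩
      have : (y + τ • w) - y - (s + τ - s) • v = τ • (w - v) := by module
      rw [mem_closedBall, dist_eq_norm] at hw
      change ‖(y + τ • w) - y - (s + τ - s) • v‖ ≤ ε * (s + τ - s)
      rw [this, norm_smul, Real.norm_of_nonneg hτ.le, add_sub_cancel_left, mul_comm ε]
      gcongr
    have := hmax ⟨(s + τ, y + τ • w), hwS, by simp only; linarith,
      hrtrans (0, x) (s, y) _ ⟨hs0, by simpa using hsy⟩ hrel⟩ hrel
    simp only at this
    linarith
  obtain rfl : s = T := le_antisymm hsT hsT'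
  exact exists_mem_closedBall_add_smul_mem hT hε hyS hsy

/-- Uniform steps persist for convex combinations of directions: the set of admissible directions is
convex, because a step along `α • v + β • v'` can be split into one along `v` and one along `v'`. -/
lemma exists_step_of_mem_convexHull {S D : Set X} {x₀ : X} {M ε δ : ℝ} (hε : 0 ≤ ε)
    (hM : ∀ v ∈ D, ‖v‖ ≤ M)
    (hD : ∀ v ∈ D, ∀ x ∈ S, ∀ t : ℝ, 0 ≤ t → ‖x - x₀‖ + t * (M + ε) ≤ δ →
      ∃ w ∈ closedBall v ε, x + t • w ∈ S) :
    ∀ v ∈ convexHull ℝ D, ∀ x ∈ S, ∀ t : ℝ, 0 ≤ t → ‖x - x₀‖ + t * (M + ε) ≤ δ →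
      ∃ w ∈ closedBall v ε, x + t • w ∈ S := by
  let E : Set X := {v | ‖v‖ ≤ M ∧ ∀ x ∈ S, ∀ t : ℝ, 0 ≤ t → ‖x - x₀‖ + t * (M + ε) ≤ δ →
    ∃ w ∈ closedBall v ε, x + t • w ∈ S}
  have hE : Convex ℝ E := by
    rintro v ⟨hv, hv'⟩ v' ⟨hvM, hvM'⟩ α β hα hβ hαβ
    refine ⟨?_, fun x hx t ht hxt => ?_⟩
    · simpa using (convex_closedBall (0 : X) M) (by simpa using hv) (by simpa using hvM) hα hβ hαβ
    have hsum : t * (M + ε) = α * t * (M + ε) + β * t * (M + ε) := by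
      rw [← add_mul, ← add_mul, hαβ, one_mul]
    have hMε : 0 ≤ M + ε := add_nonneg ((norm_nonneg v).trans hv) hε
    have h1 : 0 ≤ α * t * (M + ε) := by positivity
    have h2 : 0 ≤ β * t * (M + ε) := by positivity
    obtain ⟨w, hw, hwS⟩ := hv' x hx (α * t) (by positivity) (by linarith)
    have hwn : ‖w‖ ≤ M + ε := by
      rw [mem_closedBall, dist_eq_norm] at hw
      have := norm_add_le v (w - v)
      rw [add_sub_cancel] at this
      linarith
    obtain ⟨w', hw', hwS'⟩ := hvM' _ hwS (β * t) (by positivity) (by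
      have h3 := norm_add_le (x - x₀) ((α * t) • w)
      rw [norm_smul, Real.norm_of_nonneg (by positivity),
        show x - x₀ + (α * t) • w = x + (α * t) • w - x₀ by abel] at h3
      have h4 : α * t * ‖w‖ ≤ α * t * (M + ε) := by gcongr
      linarith)
    refine ⟨α • w + β • w', ?_, ?_⟩
    · rw [mem_closedBall, dist_eq_norm] at *
      have : α • w + β • w' - (α • v + β • v') = α • (w - v) + β • (w' - v') := by module
      rw [this]
      refine (norm_add_le _ _).trans ?_
      rw [norm_smul, norm_smul, Real.norm_of_nonneg hα, Real.norm_of_nonneg hβ]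
      calc α * ‖w - v‖ + β * ‖w' - v'‖ ≤ α * ε + β * ε := by gcongr
        _ = ε := by rw [← add_mul, hαβ, one_mul]
    · convert hwS' using 1
      module
  have hDE : D ⊆ E := fun v hv => ⟨hM v hv, hD v hv⟩
  exact fun v hv => (convexHull_min hDE hE hv).2

end Steps

/-! ### Uniform tangent sets and the Clarke tangent cone -/

section TangentCone

variable {X : Type*} [NormedAddCommGroup X] [NormedSpace ℝ X]

/-- For a closed set in a Banach space, the steps in the definition of a uniform tangent set `D` have
a length uniform in the point and in the direction, which may be any vector of `convexHull ℝ D`. -/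
lemma IsUniformTangentSet.exists_step [CompleteSpace X] {S D : Set X} {x₀ : X} {M : ℝ}
    (hD : IsUniformTangentSet S x₀ D) (hS : IsClosed S) (hM : ∀ v ∈ D, ‖v‖ ≤ M)
    {ε : ℝ} (hε : 0 < ε) :
    ∃ δ : ℝ, 0 < δ ∧ ∀ v ∈ convexHull ℝ D, ∀ x ∈ S, ∀ t : ℝ, 0 ≤ t →
      ‖x - x₀‖ + t * (M + ε) ≤ δ → ∃ w ∈ closedBall v ε, x + t • w ∈ S := by
  obtain ⟨δ, hδ, h⟩ := hD.2 ε hε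
  refine ⟨δ, hδ, exists_step_of_mem_convexHull hε.le hM fun v hv x hx t ht hxt => ?_⟩
  refine exists_step_of_forall_exists_step hS hε.le (h v hv) hx ht (le_trans ?_ hxt)
  gcongr
  exact hM v hv

lemma IsUniformTangentSet.convexHull_subset_clarkeTangentCone [CompleteSpace X] {S D : Set X}
    {x₀ : X} (hD : IsUniformTangentSet S x₀ D) (hS : IsClosed S) :
    convexHull ℝ D ⊆ clarkeTangentCone S x₀ := by
  intro v hv ε hε
  obtain ⟨M, hMpos, hM⟩ := hD.1.exists_pos_norm_le
  obtain ⟨δ, hδ, h⟩ := hD.exists_step hS hM hε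
  have hpos : 0 < M + ε := by positivity
  refine ⟨δ / 2, by positivity, δ / 2 / (M + ε), by positivity, fun x hx t ht => ?_⟩
  have h1 := (le_div_iff₀ hpos).1 ht.2
  have h2 := hx.2
  rw [mem_closedBall, dist_eq_norm] at h2
  exact h v hv x hx.1 t ht.1 (by linarith)

/-- The Clarke tangent cone as a pointed convex cone. -/
def clarkeTangentPointedCone (S : Set X) (x₀ : X) : PointedCone ℝ X where
  carrier := clarkeTangentCone S x₀
  zero_mem' := fun ε hε =>
    ⟨1, one_pos, 1, one_pos, fun x hx t _ => ⟨0, mem_closedBall_self hε.le, by simpa using hx.1⟩⟩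
  add_mem' := by
    intro v v' hv hv' ε hε
    obtain ⟨δ, hδ, lam, hlam, h⟩ := hv (ε / 2) (by positivity)
    obtain ⟨δ', hδ', lam', hlam', h'⟩ := hv' (ε / 2) (by positivity)
    have hpos : 0 < ‖v‖ + ε := by positivity
    refine ⟨min δ (δ' / 2), by positivity, min (min lam lam') (δ' / 2 / (‖v‖ + ε)), by positivity,
      fun x hx t ht => ?_⟩
    obtain ⟨hx, hxδ⟩ := hx
    rw [mem_closedBall, dist_eq_norm] at hxδ
    simp only [mem_Icc, le_min_iff] at hxδ ht
    obtain ⟨ht0, ⟨ht1, ht2⟩, ht3⟩ := ht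
    rw [le_div_iff₀ hpos] at ht3
    obtain ⟨w, hw, hwS⟩ := h x ⟨hx, by rw [mem_closedBall, dist_eq_norm]; exact hxδ.1⟩ t ⟨ht0, ht1⟩
    rw [mem_closedBall, dist_eq_norm] at hw
    obtain ⟨w', hw', hwS'⟩ := h' (x + t • w) ⟨hwS, by
      have h1 := norm_add_le v (w - v)
      have h2 := norm_add_le (x - x₀) (t • w)
      rw [add_sub_cancel] at h1
      rw [norm_smul, Real.norm_of_nonneg ht0] at h2
      have h3 : t * ‖w‖ ≤ t * (‖v‖ + ε) := by gcongr; linarith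
      rw [mem_closedBall, dist_eq_norm, add_sub_right_comm]
      linarith⟩ t ⟨ht0, ht2⟩
    rw [mem_closedBall, dist_eq_norm] at hw'
    refine ⟨w + w', ?_, by rwa [smul_add, ← add_assoc]⟩
    rw [mem_closedBall, dist_eq_norm, add_sub_add_comm]
    linarith [norm_add_le (w - v) (w' - v')]
  smul_mem' := by
    rintro ⟨c, hc⟩ v hv ε hε
    have hc1 : 0 < c + 1 := by positivity
    obtain ⟨δ, hδ, lam, hlam, h⟩ := hv (ε / (c + 1)) (by positivity)
    refine ⟨δ, hδ, lam / (c + 1), by positivity, fun x hx t ht => ?_⟩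
    have ht0 := ht.1
    have ht1 := (le_div_iff₀ hc1).1 ht.2
    obtain ⟨w, hw, hwS⟩ := h x hx (t * c) ⟨by positivity, by nlinarith⟩
    refine ⟨c • w, ?_, by rwa [smul_smul]⟩
    rw [mem_closedBall, dist_eq_norm] at hw ⊢
    change ‖c • w - c • v‖ ≤ ε
    rw [← smul_sub, norm_smul, Real.norm_of_nonneg hc]
    rw [le_div_iff₀ hc1] at hw
    nlinarith [norm_nonneg (w - v)]

lemma isClosed_clarkeTangentCone (S : Set X) (x₀ : X) : IsClosed (clarkeTangentCone S x₀) := by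
  refine isClosed_of_closure_subset fun v hv ε hε => ?_
  obtain ⟨v', hv', hvv'⟩ := Metric.mem_closure_iff.1 hv (ε / 2) (by positivity)
  obtain ⟨δ, hδ, lam, hlam, h⟩ := hv' (ε / 2) (by positivity)
  refine ⟨δ, hδ, lam, hlam, fun x hx t ht => ?_⟩
  obtain ⟨w, hw, hwS⟩ := h x hx t ht
  refine ⟨w, ?_, hwS⟩
  rw [mem_closedBall] at hw ⊢
  linarith [dist_triangle_right w v v', dist_comm v v', dist_triangle w v' v]

end TangentCone

/-! ### Newton iteration -/

section Newton

variable {X : Type*} [NormedAddCommGroup X] [NormedSpace ℝ X]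

/-- Newton iteration: if one can move inside `A` along the directions of `CA` and inside `B` along
those of `CB`, and `CA - CB` is dense in a ball around the origin, then near `x₀` the distance from
`a ∈ A` to `A ∩ B` is at most a constant times `‖a - b‖`, for every `b ∈ B`. The hypotheses `haδ` and
`hbδ` ensure that the iterates starting from `a` and `b` stay where `stepA` and `stepB` apply. -/
lemma exists_mem_inter_of_step [CompleteSpace X] {A B CA CB : Set X} (hA : IsClosed A)
    (hB : IsClosed B) {x₀ : X} {M ρ δ : ℝ} (hM : 0 ≤ M) (hρ : 0 < ρ)
    (hCA : ∀ v ∈ CA, ‖v‖ ≤ M) (hCB : ∀ v ∈ CB, ‖v‖ ≤ M)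
    (hC : closedBall (0 : X) ρ ⊆ closure (CA - CB))
    (stepA : ∀ v ∈ CA, ∀ x ∈ A, ∀ t : ℝ, 0 ≤ t → ‖x - x₀‖ + t * (M + ρ / 8) ≤ δ →
      ∃ w ∈ closedBall v (ρ / 8), x + t • w ∈ A)
    (stepB : ∀ v ∈ CB, ∀ x ∈ B, ∀ t : ℝ, 0 ≤ t → ‖x - x₀‖ + t * (M + ρ / 8) ≤ δ →
      ∃ w ∈ closedBall v (ρ / 8), x + t • w ∈ B)
    {a b : X} (ha : a ∈ A) (hb : b ∈ B)
    (haδ : ‖a - x₀‖ + 2 * ((M + ρ / 8) / ρ) * ‖a - b‖ ≤ δ)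
    (hbδ : ‖b - x₀‖ + 2 * ((M + ρ / 8) / ρ) * ‖a - b‖ ≤ δ) :
    ∃ z ∈ A ∩ B, ‖z - a‖ ≤ 2 * ((M + ρ / 8) / ρ) * ‖a - b‖ := by
  set K := (M + ρ / 8) / ρ with hK
  have hK0 : 0 ≤ K := by positivity
  let P := {p : X × X // p.1 ∈ A ∧ p.2 ∈ B ∧ ‖p.1 - x₀‖ + 2 * K * ‖p.1 - p.2‖ ≤ δ ∧
    ‖p.2 - x₀‖ + 2 * K * ‖p.1 - p.2‖ ≤ δ}
  have hstep : ∀ p : P, ∃ p' : P, ‖p'.1.1 - p'.1.2‖ ≤ ‖p.1.1 - p.1.2‖ / 2 ∧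
      ‖p'.1.1 - p.1.1‖ ≤ K * ‖p.1.1 - p.1.2‖ := by
    rintro ⟨⟨a, b⟩, ha, hb, haδ, hbδ⟩
    simp only at ha hb haδ hbδ ⊢
    set h := ‖a - b‖ with hh
    have hh0 : 0 ≤ h := norm_nonneg _
    -- A step of length `t` along a vector of norm `ρ` covers the gap exactly.
    set t := h / ρ with ht
    have ht0 : 0 ≤ t := by positivity
    have htρ : t * ρ = h := by rw [ht]; field_simp
    have htK : t * (M + ρ / 8) = K * h := by rw [ht, hK]; field_simp
    have hKh : 0 ≤ K * h := by positivity
    have hu : ∃ u ∈ closedBall (0 : X) ρ, t • u = b - a := by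
      rcases hh0.eq_or_lt with h0 | h0
      · have : a = b := by rwa [hh, eq_comm, norm_eq_zero, sub_eq_zero] at h0
        exact ⟨0, mem_closedBall_self hρ.le, by simp [this]⟩
      · have ht0' : 0 < t := by positivity
        refine ⟨t⁻¹ • (b - a), ?_, smul_inv_smul₀ ht0'.ne' _⟩
        rw [mem_closedBall_zero_iff, norm_smul, norm_inv, Real.norm_of_nonneg ht0, norm_sub_rev,
          inv_mul_le_iff₀ ht0', htρ]
    obtain ⟨u, hu, htu⟩ := hu
    obtain ⟨_, ⟨va, hva, vb, hvb, rfl⟩, hd⟩ := Metric.mem_closure_iff.1 (hC hu) (ρ / 8)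
      (by positivity)
    rw [dist_eq_norm] at hd
    obtain ⟨wa, hwa, hwA⟩ := stepA va hva a ha t ht0 (by linarith)
    obtain ⟨wb, hwb, hwB⟩ := stepB vb hvb b hb t ht0 (by linarith)
    rw [mem_closedBall, dist_eq_norm] at hwa hwb
    -- `va - vb` is within `ρ / 8` of `u`, and the actual directions `wa`, `wb` within `ρ / 8` of `va`,
    -- `vb`: the new gap is at most `t * (3 * ρ / 8) ≤ h / 2`.
    have hmove : ∀ v w : X, ‖v‖ ≤ M → ‖w - v‖ ≤ ρ / 8 → ‖t • w‖ ≤ K * h := by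
      intro v w hv hw
      have := norm_add_le v (w - v)
      rw [add_sub_cancel] at this
      rw [norm_smul, Real.norm_of_nonneg ht0, ← htK]
      gcongr
      linarith
    have hma := hmove va wa (hCA va hva) hwa
    have hmb := hmove vb wb (hCB vb hvb) hwb
    have hgap : ‖a + t • wa - (b + t • wb)‖ ≤ h / 2 := by
      have : a + t • wa - (b + t • wb)
          = t • ((wa - va) + (vb - wb) - (u - (va - vb))) := by
        have : a - b = -(t • u) := by rw [htu]; abel
        rw [add_sub_add_comm, this]
        module
      rw [this, norm_smul, Real.norm_of_nonneg ht0]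
      rw [norm_sub_rev] at hwb
      have h1 := norm_sub_le ((wa - va) + (vb - wb)) (u - (va - vb))
      have h2 := norm_add_le (wa - va) (vb - wb)
      have : t * ‖(wa - va) + (vb - wb) - (u - (va - vb))‖ ≤ t * (ρ / 2) := by
        gcongr
        linarith
      linarith
    have hgapK := mul_le_mul_of_nonneg_left hgap (show 0 ≤ 2 * K by positivity)
    refine ⟨⟨(a + t • wa, b + t • wb), hwA, hwB, ?_, ?_⟩, hgap, by simpa using hma⟩
    · simp only
      have := norm_add_le (a - x₀) (t • wa)
      rw [add_sub_right_comm]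
      linarith
    · simp only
      have := norm_add_le (b - x₀) (t • wb)
      rw [add_sub_right_comm b]
      linarith
  choose nx hnx hnx' using hstep
  let p : ℕ → P := fun n => nx^[n] ⟨(a, b), ha, hb, haδ, hbδ⟩
  have hp : ∀ n, p (n + 1) = nx (p n) := fun n => Function.iterate_succ_apply' nx n _
  have hgap : ∀ n, ‖(p n).1.1 - (p n).1.2‖ ≤ ‖a - b‖ / 2 ^ n := by
    intro n
    induction n with
    | zero => simp [p]
    | succ n ih =>
      rw [hp, pow_succ, ← div_div]
      exact (hnx _).trans (by gcongr)
  have hdist : ∀ n, dist (p n).1.1 (p (n + 1)).1.1 ≤ 2 * K * ‖a - b‖ / 2 / 2 ^ n := by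
    intro n
    rw [hp, dist_comm, dist_eq_norm]
    refine (hnx' _).trans ((mul_le_mul_of_nonneg_left (hgap n) hK0).trans_eq ?_)
    ring
  obtain ⟨z, hz⟩ := cauchySeq_tendsto_of_complete (cauchySeq_of_le_geometric_two hdist)
  have hgap0 : Filter.Tendsto (fun n => (p n).1.1 - (p n).1.2) Filter.atTop (nhds 0) := by
    refine squeeze_zero_norm hgap ?_
    have := (tendsto_inv_atTop_zero.comp
      (tendsto_pow_atTop_atTop_of_one_lt (one_lt_two (α := ℝ)))).const_mul ‖a - b‖
    simpa [div_eq_mul_inv] using this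
  have hz' : Filter.Tendsto (fun n => (p n).1.2) Filter.atTop (nhds z) := by
    simpa using hz.sub hgap0
  refine ⟨z, ⟨hA.mem_of_tendsto hz (.of_forall fun n => (p n).2.1),
    hB.mem_of_tendsto hz' (.of_forall fun n => (p n).2.2.1)⟩, ?_⟩
  rw [norm_sub_rev, ← dist_eq_norm]
  exact dist_le_of_le_geometric_two_of_tendsto₀ hdist hz

end Newton

/-! ### Sums of polar cones -/

section Polar

variable {X : Type*} [NormedAddCommGroup X] [NormedSpace ℝ X]

/-- Two closed convex cones whose bounded parts have differences dense in a ball around the origin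
generate the whole space, with a linear bound: the Newton iteration applied to `P` and `u + Q`. -/
lemma PointedCone.exists_sub_eq_of_closedBall_subset_closure [CompleteSpace X]
    {P Q : PointedCone ℝ X} (hP : IsClosed (P : Set X)) (hQ : IsClosed (Q : Set X))
    {CA CB : Set X} (hCA : CA ⊆ P) (hCB : CB ⊆ Q) {M ρ : ℝ} (hM : 0 ≤ M) (hρ : 0 < ρ)
    (hMA : ∀ v ∈ CA, ‖v‖ ≤ M) (hMB : ∀ v ∈ CB, ‖v‖ ≤ M)
    (hC : closedBall (0 : X) ρ ⊆ closure (CA - CB)) :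
    ∃ K : ℝ, ∀ u : X, ∃ a ∈ P, ∃ b ∈ Q, a - b = u ∧ ‖b‖ ≤ K * ‖u‖ := by
  set K := 2 * ((M + ρ / 8) / ρ)
  have hK : 0 ≤ K := by positivity
  refine ⟨K + 1, fun u => ?_⟩
  have hstep : ∀ (R : PointedCone ℝ X), ∀ v ∈ R, ∀ x ∈ R, ∀ t : ℝ, 0 ≤ t → x + t • v ∈ R :=
    fun R v hv x hx t ht => R.add_mem hx (R.smul_mem ht hv)
  obtain ⟨z, ⟨hzP, b, hb, hbz⟩, hz⟩ := exists_mem_inter_of_step (A := P) (B := (u + ·) '' Q)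
    (x₀ := 0) (δ := ‖u‖ + K * ‖u‖) hP ((Homeomorph.addLeft u).isClosedMap _ hQ) hM hρ hMA hMB hC
    (fun v hv x hx t ht _ => ⟨v, mem_closedBall_self (by positivity),
      hstep P v (hCA hv) x hx t ht⟩)
    (by
      rintro v hv _ ⟨x, hx, rfl⟩ t ht -
      exact ⟨v, mem_closedBall_self (by positivity), x + t • v, hstep Q v (hCB hv) x hx t ht,
        by simp only [add_assoc]⟩)
    P.zero_mem ⟨0, Q.zero_mem, add_zero u⟩ (by simp [K]) (by simp [K])
  simp only at hbz
  simp only [sub_zero, zero_sub, norm_neg] at hz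
  refine ⟨z, hzP, b, hb, by rw [← hbz]; abel, ?_⟩
  have : b = z - u := by rw [← hbz]; abel
  rw [this]
  linarith [norm_sub_le z u, show 2 * ((M + ρ / 8) / ρ) * ‖u‖ = K * ‖u‖ from rfl]

/-- If every vector is a difference of elements of `P` and `Q`, with a linear bound, then every
continuous functional in the polar of `P ∩ Q` is a sum of elements of the polars of `P` and `Q`. -/
lemma PointedCone.exists_add_eq_of_forall_nonpos {P Q : PointedCone ℝ X} {K : ℝ}
    (hPQ : ∀ u : X, ∃ a ∈ P, ∃ b ∈ Q, a - b = u ∧ ‖b‖ ≤ K * ‖u‖)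
    {φ : X →L[ℝ] ℝ} (hφ : ∀ v ∈ P, v ∈ Q → φ v ≤ 0) :
    ∃ φ₁ φ₂ : X →L[ℝ] ℝ, (∀ v ∈ P, φ₁ v ≤ 0) ∧ (∀ v ∈ Q, φ₂ v ≤ 0) ∧ φ₁ + φ₂ = φ := by
  let V : X → Set ℝ := fun u => {r | ∃ a ∈ P, ∃ b ∈ Q, a - b = u ∧ r = -φ b}
  have hne : ∀ u, (V u).Nonempty := fun u => by
    obtain ⟨a, ha, b, hb, h, -⟩ := hPQ u
    exact ⟨_, a, ha, b, hb, h, rfl⟩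
  -- Any decomposition `-u = a - b` bounds `V u` from below, since adding it to a decomposition of `u`
  -- gives a common element of `P` and `Q`.
  have hbdd : ∀ u, BddBelow (V u) := fun u => by
    obtain ⟨a, ha, b, hb, h, -⟩ := hPQ (-u)
    refine ⟨φ b, ?_⟩
    rintro _ ⟨a', ha', b', hb', h', rfl⟩
    have hab : a + a' = b + b' := by
      have h0 : (a - b) + (a' - b') = 0 := by rw [h, h']; simp
      rw [← sub_eq_zero, ← h0]; abel
    have := hφ (b + b') (hab ▸ P.add_mem ha ha') (Q.add_mem hb hb')
    rw [map_add] at this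
    linarith
  let q : X → ℝ := fun u => sInf (V u)
  have hq : ∀ a ∈ P, ∀ b ∈ Q, q (a - b) ≤ -φ b := fun a ha b hb =>
    csInf_le (hbdd _) ⟨a, ha, b, hb, rfl, rfl⟩
  have hq_add : ∀ x y, q (x + y) ≤ q x + q y := by
    intro x y
    rw [← sub_le_iff_le_add]
    refine le_csInf (hne x) ?_
    rintro _ ⟨a, ha, b, hb, rfl, rfl⟩
    rw [sub_le_comm]
    refine le_csInf (hne y) ?_
    rintro _ ⟨a', ha', b', hb', rfl, rfl⟩
    have := hq _ (P.add_mem ha ha') _ (Q.add_mem hb hb')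
    rw [add_sub_add_comm, map_add] at this
    linarith
  have hq_smul_le : ∀ c : ℝ, 0 < c → ∀ x, q (c • x) ≤ c * q x := by
    intro c hc x
    rw [← div_le_iff₀' hc]
    refine le_csInf (hne x) ?_
    rintro _ ⟨a, ha, b, hb, rfl, rfl⟩
    rw [div_le_iff₀' hc, smul_sub]
    refine (hq _ (P.smul_mem hc.le ha) _ (Q.smul_mem hc.le hb)).trans_eq ?_
    simp
  have hq_smul : ∀ c : ℝ, 0 < c → ∀ x, q (c • x) = c * q x := by
    refine fun c hc x => le_antisymm (hq_smul_le c hc x) ?_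
    have := hq_smul_le c⁻¹ (inv_pos.2 hc) (c • x)
    rwa [inv_smul_smul₀ hc.ne', ← div_eq_inv_mul, le_div_iff₀' hc] at this
  have hq_zero : q 0 = 0 := by
    have := hq_smul 2 two_pos 0
    rw [smul_zero] at this
    linarith
  obtain ⟨g, -, hg⟩ := exists_extension_of_le_sublinear (⟨⊥, 0⟩ : X →ₗ.[ℝ] ℝ) q hq_smul hq_add
    (by rintro ⟨x, hx⟩; obtain rfl := (Submodule.mem_bot ℝ).1 hx; simp [hq_zero])
  have hgK : ∀ u, g u ≤ ‖φ‖ * K * ‖u‖ := fun u => by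
    obtain ⟨a, ha, b, hb, rfl, h⟩ := hPQ u
    refine (hg _).trans ((hq a ha b hb).trans ?_)
    rw [← map_neg, mul_assoc]
    refine (le_abs_self _).trans ((φ.le_opNorm _).trans ?_)
    rw [norm_neg]
    gcongr
  refine ⟨g.mkContinuous (‖φ‖ * K) fun u => abs_le.2 ⟨?_, hgK u⟩,
    φ - g.mkContinuous (‖φ‖ * K) fun u => abs_le.2 ⟨?_, hgK u⟩, fun v hv => ?_, fun v hv => ?_,
    by simp⟩
  · simpa [neg_le] using hgK (-u)
  · simpa [neg_le] using hgK (-u)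
  · have := (hg _).trans (hq v hv 0 Q.zero_mem)
    simpa using this
  · have := (hg _).trans (hq 0 P.zero_mem v hv)
    simpa using this

end Polar

/-! ### Tangent and normal cones of an intersection -/

section Intersection

variable {X : Type*} [NormedAddCommGroup X] [NormedSpace ℝ X]

/-- The transversality condition in terms of the convex hulls of the uniform tangent sets, with a
common bound on their norms. -/
lemma StronglyTangentiallyTransversal.exists_convexHull [CompleteSpace X] {A B : Set X} {x₀ : X}
    (h : StronglyTangentiallyTransversal A B x₀) :
    ∃ DA DB : Set X, IsUniformTangentSet A x₀ DA ∧ IsUniformTangentSet B x₀ DB ∧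
      ∃ M ρ : ℝ, 0 < M ∧ 0 < ρ ∧ (∀ v ∈ convexHull ℝ DA, ‖v‖ ≤ M) ∧
        (∀ v ∈ convexHull ℝ DB, ‖v‖ ≤ M) ∧
        closedBall (0 : X) ρ ⊆ closure (convexHull ℝ DA - convexHull ℝ DB) := by
  obtain ⟨DA, DB, hDA, hDB, ρ, hρ, hball⟩ := h
  obtain ⟨M, hM, hMD⟩ := (hDA.1.union hDB.1).exists_pos_norm_le
  have hhull : ∀ D : Set X, (∀ v ∈ D, ‖v‖ ≤ M) → ∀ v ∈ convexHull ℝ D, ‖v‖ ≤ M := by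
    intro D hD v hv
    have hsub : D ⊆ closedBall 0 M := fun v hv => by simpa using hD v hv
    simpa using convexHull_min hsub (convex_closedBall 0 M) hv
  exact ⟨DA, DB, hDA, hDB, M, ρ, hM, hρ, hhull DA fun v hv => hMD v (.inl hv),
    hhull DB fun v hv => hMD v (.inr hv), by rwa [← convexHull_sub]⟩

/-- Strongly tangentially transversal closed sets satisfy a linear estimate for the distance to their
intersection. -/
theorem StronglyTangentiallyTransversal.exists_mem_inter [CompleteSpace X] {A B : Set X}
    {x₀ : X} (h : StronglyTangentiallyTransversal A B x₀) (hA : IsClosed A) (hB : IsClosed B) :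
    ∃ K δ : ℝ, 0 ≤ K ∧ 0 < δ ∧ ∀ a ∈ A, ∀ b ∈ B, ‖a - x₀‖ + K * ‖a - b‖ ≤ δ →
      ‖b - x₀‖ + K * ‖a - b‖ ≤ δ → ∃ z ∈ A ∩ B, ‖z - a‖ ≤ K * ‖a - b‖ := by
  obtain ⟨DA, DB, hDA, hDB, M, ρ, hM, hρ, hMA, hMB, hball⟩ := h.exists_convexHull
  obtain ⟨δA, hδA, stepA⟩ := hDA.exists_step hA (fun v hv => hMA v (subset_convexHull ℝ _ hv))
    (show 0 < ρ / 8 by positivity)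
  obtain ⟨δB, hδB, stepB⟩ := hDB.exists_step hB (fun v hv => hMB v (subset_convexHull ℝ _ hv))
    (show 0 < ρ / 8 by positivity)
  exact ⟨2 * ((M + ρ / 8) / ρ), min δA δB, by positivity, lt_min hδA hδB, fun a ha b hb hab hba =>
    exists_mem_inter_of_step hA hB hM.le hρ hMA hMB hball
      (fun v hv x hx t ht hxt => stepA v hv x hx t ht (hxt.trans (min_le_left _ _)))
      (fun v hv x hx t ht hxt => stepB v hv x hx t ht (hxt.trans (min_le_right _ _)))
      ha hb hab hba⟩

theorem StronglyTangentiallyTransversal.clarkeTangentCone_inter_subset [CompleteSpace X]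
    {A B : Set X} {x₀ : X} (h : StronglyTangentiallyTransversal A B x₀) (hA : IsClosed A)
    (hB : IsClosed B) :
    clarkeTangentCone A x₀ ∩ clarkeTangentCone B x₀ ⊆ clarkeTangentCone (A ∩ B) x₀ := by
  obtain ⟨K, δ, hK, hδ, hinter⟩ := h.exists_mem_inter hA hB
  rintro v ⟨hvA, hvB⟩ ε hε
  -- With errors at most `η` in each set, the gap is at most `2 * η * t`, and passing to the
  -- intersection costs `K * (2 * η * t)` on top of `η * t`.
  set η := ε / (2 * K + 1) with hη
  have hη0 : 0 < η := by positivity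
  have hηε : K * (2 * η) + η = ε := by rw [hη]; field_simp
  obtain ⟨δA, hδA, lamA, hlamA, hA'⟩ := hvA η hη0
  obtain ⟨δB, hδB, lamB, hlamB, hB'⟩ := hvB η hη0
  have hpos : 0 < ‖v‖ + ε := by positivity
  refine ⟨min (min δA δB) (δ / 2), by positivity, min (min lamA lamB) (δ / 2 / (‖v‖ + ε)),
    by positivity, fun x hx t ht => ?_⟩
  obtain ⟨⟨hxA, hxB⟩, hxδ⟩ := hx
  simp only [mem_closedBall, le_min_iff, mem_Icc] at hxδ ht
  obtain ⟨ht0, ⟨htA, htB⟩, ht⟩ := ht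
  rw [le_div_iff₀ hpos] at ht
  obtain ⟨wa, hwa, haA⟩ := hA' x ⟨hxA, hxδ.1.1⟩ t ⟨ht0, htA⟩
  obtain ⟨wb, hwb, hbB⟩ := hB' x ⟨hxB, hxδ.1.2⟩ t ⟨ht0, htB⟩
  rw [mem_closedBall, dist_eq_norm] at hwa hwb
  rw [dist_eq_norm] at hxδ
  have hab : ‖x + t • wa - (x + t • wb)‖ ≤ t * (2 * η) := by
    have : x + t • wa - (x + t • wb) = t • ((wa - v) - (wb - v)) := by module
    rw [this, norm_smul, Real.norm_of_nonneg ht0]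
    gcongr
    linarith [norm_sub_le (wa - v) (wb - v)]
  have hKab := mul_le_mul_of_nonneg_left hab hK
  have hKt : t * (‖v‖ + ε) = t * (‖v‖ + η) + K * (t * (2 * η)) := by rw [← hηε]; ring
  have hnear : ∀ w : X, ‖w - v‖ ≤ η →
      ‖x + t • w - x₀‖ + K * ‖x + t • wa - (x + t • wb)‖ ≤ δ := by
    intro w hw
    have h1 := norm_add_le v (w - v)
    rw [add_sub_cancel] at h1
    have h2 := norm_add_le (x - x₀) (t • w)
    rw [norm_smul, Real.norm_of_nonneg ht0, ← add_sub_right_comm] at h2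
    have h3 : t * ‖w‖ ≤ t * (‖v‖ + η) := by gcongr; linarith
    linarith [hxδ.2]
  obtain ⟨z, hz, hza⟩ := hinter _ haA _ hbB (hnear wa hwa) (hnear wb hwb)
  refine exists_mem_closedBall_add_smul_mem ht0 hε.le hz ?_
  have h1 := norm_add_le (z - (x + t • wa)) (t • (wa - v))
  rw [show z - (x + t • wa) + t • (wa - v) = z - x - t • v by module, norm_smul,
    Real.norm_of_nonneg ht0] at h1
  have h2 : t * ‖wa - v‖ ≤ t * η := by gcongr
  have h3 : ε * t = K * (t * (2 * η)) + t * η := by rw [← hηε]; ring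
  linarith

theorem StronglyTangentiallyTransversal.clarkeNormalCone_inter_subset [CompleteSpace X]
    {A B : Set X} {x₀ : X} (h : StronglyTangentiallyTransversal A B x₀) (hA : IsClosed A)
    (hB : IsClosed B) :
    clarkeNormalCone (A ∩ B) x₀ ⊆ clarkeNormalCone A x₀ + clarkeNormalCone B x₀ := by
  intro φ hφ
  obtain ⟨DA, DB, hDA, hDB, M, ρ, hM, hρ, hMA, hMB, hball⟩ := h.exists_convexHull
  obtain ⟨K, hK⟩ := PointedCone.exists_sub_eq_of_closedBall_subset_closure
    (P := clarkeTangentPointedCone A x₀) (Q := clarkeTangentPointedCone B x₀)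
    (isClosed_clarkeTangentCone A x₀) (isClosed_clarkeTangentCone B x₀)
    (hDA.convexHull_subset_clarkeTangentCone hA) (hDB.convexHull_subset_clarkeTangentCone hB)
    hM.le hρ hMA hMB hball
  obtain ⟨φ₁, φ₂, h₁, h₂, hsum⟩ := PointedCone.exists_add_eq_of_forall_nonpos hK (φ := φ)
    fun v hvA hvB => hφ v (h.clarkeTangentCone_inter_subset hA hB ⟨hvA, hvB⟩)
  exact ⟨φ₁, h₁, φ₂, h₂, hsum⟩

end Intersection

/-! ### Subdifferential of a sum -/

section Sum

variable {X : Type*} [NormedAddCommGroup X] [NormedSpace ℝ X]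

/-- Tangent vectors lift along nonexpansive linear maps with norm preserving lifts, such as coordinate
projections. -/
lemma mem_clarkeTangentCone_preimage {Y : Type*} [NormedAddCommGroup Y] [NormedSpace ℝ Y]
    {π : X →L[ℝ] Y} (hπ : ∀ x, ‖π x‖ ≤ ‖x‖) (hlift : ∀ y, ∃ x, π x = y ∧ ‖x‖ ≤ ‖y‖)
    {S : Set Y} {x₀ v : X} (hv : π v ∈ clarkeTangentCone S (π x₀)) :
    v ∈ clarkeTangentCone (π ⁻¹' S) x₀ := by
  intro ε hε
  obtain ⟨δ, hδ, lam, hlam, h⟩ := hv ε hε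
  refine ⟨δ, hδ, lam, hlam, fun x hx t ht => ?_⟩
  have hπx : π x ∈ closedBall (π x₀) δ := by
    have := hx.2
    rw [mem_closedBall, dist_eq_norm] at this ⊢
    rw [← map_sub]
    exact (hπ _).trans this
  obtain ⟨w, hw, hwS⟩ := h (π x) ⟨hx.1, hπx⟩ t ht
  obtain ⟨z, hz, hzn⟩ := hlift (w - π v)
  rw [mem_closedBall, dist_eq_norm] at hw
  refine ⟨v + z, by rw [mem_closedBall, dist_eq_norm, add_sub_cancel_left]; exact hzn.trans hw, ?_⟩
  rw [mem_preimage, map_add, map_smul, map_add, hz, add_sub_cancel]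
  exact hwS

lemma isClosed_epigraph {E : Type*} [TopologicalSpace E] {f : E → EReal}
    (hf : LowerSemicontinuous f) :
    IsClosed (epigraph f) := by
  have h := hf.isClosed_epigraph
  have hc : Continuous fun p : E × ℝ => (p.1, (p.2 : EReal)) :=
    continuous_fst.prodMk (continuous_coe_real_ereal.comp continuous_snd)
  exact h.preimage hc

/-- A tangent vector to the intersection of the lifted epigraphs of `f₁` and `f₂` gives one to the
epigraph of the sum. A point `(x, r)` of the latter is lifted to `(x, f₁ x, r - f₁ x)`, and lower
semicontinuity of both functions is what keeps this lift close to the base point. -/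
lemma mem_clarkeTangentCone_epigraph_add {f₁ f₂ : X → EReal} {x₀ : X}
    (h₁ : LowerSemicontinuous f₁) (h₂ : LowerSemicontinuous f₂)
    (hb₁ : ∀ x, f₁ x ≠ ⊥) (hb₂ : ∀ x, f₂ x ≠ ⊥) (ht₁ : f₁ x₀ ≠ ⊤) (ht₂ : f₂ x₀ ≠ ⊤)
    {v : X} {r₁ r₂ : ℝ}
    (hv : (v, r₁, r₂) ∈ clarkeTangentCone ({p : X × ℝ × ℝ | f₁ p.1 ≤ (p.2.1 : EReal)} ∩
      {p : X × ℝ × ℝ | f₂ p.1 ≤ (p.2.2 : EReal)}) (x₀, (f₁ x₀).toReal, (f₂ x₀).toReal)) :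
    (v, r₁ + r₂) ∈
      clarkeTangentCone (epigraph fun x => f₁ x + f₂ x) (x₀, (f₁ x₀ + f₂ x₀).toReal) := by
  intro ε hε
  obtain ⟨δ, hδ, lam, hlam, h⟩ := hv (ε / 2) (by positivity)
  have hlsc : ∀ f : X → EReal, LowerSemicontinuous f → f x₀ ≠ ⊤ → f x₀ ≠ ⊥ →
      ∀ᶠ x in nhds x₀, (((f x₀).toReal - δ / 3 : ℝ) : EReal) < f x := fun f hf ht hb =>
    hf x₀ _ <| (EReal.coe_lt_coe_iff.2 (by linarith : (f x₀).toReal - δ / 3 < _)).trans_eq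
      (EReal.coe_toReal ht hb)
  obtain ⟨η, hη, hη'⟩ := Metric.eventually_nhds_iff_ball.1
    ((hlsc f₁ h₁ ht₁ (hb₁ _)).and (hlsc f₂ h₂ ht₂ (hb₂ _)))
  refine ⟨min (η / 2) (δ / 3), by positivity, lam, hlam, ?_⟩
  rintro ⟨x, r⟩ ⟨hx, hxball⟩ t ht
  rw [EReal.toReal_add ht₁ (hb₁ _) ht₂ (hb₂ _)] at hxball
  simp only [mem_closedBall, Prod.dist_eq, max_le_iff, le_min_iff] at hxball
  obtain ⟨⟨hxη, -⟩, hxδ, hr⟩ := hxball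
  obtain ⟨hx₁, hx₂⟩ := hη' x (by rw [mem_ball]; linarith)
  simp only [epigraph, mem_ofPred_eq] at hx
  have hne₁ : f₁ x ≠ ⊤ := fun h => by
    rw [h, EReal.top_add_of_ne_bot (hb₂ x)] at hx
    exact EReal.coe_ne_top r (top_le_iff.1 hx)
  have hne₂ : f₂ x ≠ ⊤ := fun h => by
    rw [h, EReal.add_top_of_ne_bot (hb₁ x)] at hx
    exact EReal.coe_ne_top r (top_le_iff.1 hx)
  -- Here `a ≥ f₁ x₀ - δ / 3` and `a ≤ r - b ≤ f₁ x₀ + 2 * δ / 3`, and similarly for `r - a`.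
  obtain ⟨a, ha⟩ : ∃ a : ℝ, f₁ x = a := ⟨_, (EReal.coe_toReal hne₁ (hb₁ x)).symm⟩
  obtain ⟨b, hb⟩ : ∃ b : ℝ, f₂ x = b := ⟨_, (EReal.coe_toReal hne₂ (hb₂ x)).symm⟩
  rw [ha, hb, ← EReal.coe_add, EReal.coe_le_coe_iff] at hx
  rw [ha, EReal.coe_lt_coe_iff] at hx₁
  rw [hb, EReal.coe_lt_coe_iff] at hx₂
  rw [Real.dist_eq, abs_le] at hr
  have hball : (x, a, r - a) ∈ closedBall (x₀, (f₁ x₀).toReal, (f₂ x₀).toReal) δ := by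
    simp only [mem_closedBall, Prod.dist_eq, max_le_iff, Real.dist_eq, abs_le]
    refine ⟨by linarith, ⟨?_, ?_⟩, ?_, ?_⟩ <;> linarith [hr.1, hr.2]
  obtain ⟨⟨w, s₁, s₂⟩, hw, hwC₁, hwC₂⟩ := h (x, a, r - a) ⟨⟨ha.le, by
    simp only [mem_ofPred_eq, hb, EReal.coe_le_coe_iff]
    linarith⟩, hball⟩ t ht
  simp only [mem_closedBall, Prod.dist_eq, max_le_iff, Real.dist_eq] at hw
  refine ⟨(w, s₁ + s₂), ?_, ?_⟩
  · simp only [mem_closedBall, Prod.dist_eq, max_le_iff, Real.dist_eq]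
    refine ⟨by linarith [hw.1], ?_⟩
    rw [add_sub_add_comm]
    linarith [abs_add_le (s₁ - r₁) (s₂ - r₂), hw.2.1, hw.2.2]
  · simp only [mem_ofPred_eq, Prod.smul_mk, Prod.mk_add_mk, epigraph, smul_eq_mul]
      at hwC₁ hwC₂ ⊢
    refine (add_le_add hwC₁ hwC₂).trans_eq ?_
    rw [← EReal.coe_add]
    congr 1
    ring

end Sum

theorem clarkeSubdifferential_add_subset {X : Type*} [NormedAddCommGroup X] [NormedSpace ℝ X]
    [CompleteSpace X] {f₁ f₂ : X → EReal} {x₀ : X}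
    (h₁ : LowerSemicontinuous f₁) (h₂ : LowerSemicontinuous f₂)
    (hb₁ : ∀ x, f₁ x ≠ ⊥) (hb₂ : ∀ x, f₂ x ≠ ⊥) (ht₁ : f₁ x₀ ≠ ⊤) (ht₂ : f₂ x₀ ≠ ⊤)
    (h : StronglyTangentiallyTransversal
        {p : X × ℝ × ℝ | f₁ p.1 ≤ (p.2.1 : EReal)}
        {p : X × ℝ × ℝ | f₂ p.1 ≤ (p.2.2 : EReal)}
        (x₀, (f₁ x₀).toReal, (f₂ x₀).toReal)) :
    clarkeSubdifferential (fun x => f₁ x + f₂ x) x₀ ⊆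
      clarkeSubdifferential f₁ x₀ + clarkeSubdifferential f₂ x₀ := by
  rintro φ ⟨-, -, hφ⟩
  -- The lifted epigraphs are the preimages of the epigraphs under `π₁` and `π₂`.
  let π₁ : X × ℝ × ℝ →L[ℝ] X × ℝ := (ContinuousLinearMap.fst ℝ X (ℝ × ℝ)).prod
    ((ContinuousLinearMap.fst ℝ ℝ ℝ).comp (ContinuousLinearMap.snd ℝ X (ℝ × ℝ)))
  let π₂ : X × ℝ × ℝ →L[ℝ] X × ℝ := (ContinuousLinearMap.fst ℝ X (ℝ × ℝ)).prod
    ((ContinuousLinearMap.snd ℝ ℝ ℝ).comp (ContinuousLinearMap.snd ℝ X (ℝ × ℝ)))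
  have hT₁ : ∀ v : X × ℝ × ℝ,
      (v.1, v.2.1) ∈ clarkeTangentCone (epigraph f₁) (x₀, (f₁ x₀).toReal) →
      v ∈ clarkeTangentCone {p : X × ℝ × ℝ | f₁ p.1 ≤ (p.2.1 : EReal)}
        (x₀, (f₁ x₀).toReal, (f₂ x₀).toReal) := fun v hv =>
    mem_clarkeTangentCone_preimage (π := π₁) (S := epigraph f₁)
      (fun x => max_le_max le_rfl (le_max_left _ _)) (fun y => ⟨(y.1, y.2, 0), rfl, by
        simp [Prod.norm_def]⟩) hv
  have hT₂ : ∀ v : X × ℝ × ℝ,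
      (v.1, v.2.2) ∈ clarkeTangentCone (epigraph f₂) (x₀, (f₂ x₀).toReal) →
      v ∈ clarkeTangentCone {p : X × ℝ × ℝ | f₂ p.1 ≤ (p.2.2 : EReal)}
        (x₀, (f₁ x₀).toReal, (f₂ x₀).toReal) := fun v hv =>
    mem_clarkeTangentCone_preimage (π := π₂) (S := epigraph f₂)
      (fun x => max_le_max le_rfl (le_max_right _ _)) (fun y => ⟨(y.1, 0, y.2), rfl, by
        simp [Prod.norm_def]⟩) hv
  have hzero : ∀ f : X → EReal, (0, 0) ∈ clarkeTangentCone (epigraph f) (x₀, (f x₀).toReal) :=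
    fun f => (clarkeTangentPointedCone (epigraph f) (x₀, (f x₀).toReal)).zero_mem
  have hΦ : φ.comp (ContinuousLinearMap.fst ℝ X (ℝ × ℝ))
      - (ContinuousLinearMap.fst ℝ ℝ ℝ).comp (ContinuousLinearMap.snd ℝ X (ℝ × ℝ))
      - (ContinuousLinearMap.snd ℝ ℝ ℝ).comp (ContinuousLinearMap.snd ℝ X (ℝ × ℝ)) ∈
      clarkeNormalCone ({p : X × ℝ × ℝ | f₁ p.1 ≤ (p.2.1 : EReal)} ∩
        {p : X × ℝ × ℝ | f₂ p.1 ≤ (p.2.2 : EReal)}) (x₀, (f₁ x₀).toReal, (f₂ x₀).toReal) := by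
    rintro ⟨v, r₁, r₂⟩ hv
    have := hφ _ (mem_clarkeTangentCone_epigraph_add h₁ h₂ hb₁ hb₂ ht₁ ht₂ hv)
    simp only [sub_apply, ContinuousLinearMap.comp_apply,
      ContinuousLinearMap.coe_fst', ContinuousLinearMap.coe_snd'] at this ⊢
    linarith
  obtain ⟨Φ₁, hΦ₁, Φ₂, hΦ₂, hsum⟩ := h.clarkeNormalCone_inter_subset
    ((isClosed_epigraph h₁).preimage π₁.continuous) ((isClosed_epigraph h₂).preimage π₂.continuous)
    hΦ
  have hsum' : ∀ v r₁ r₂, Φ₁ (v, r₁, r₂) + Φ₂ (v, r₁, r₂) = φ v - r₁ - r₂ := fun v r₁ r₂ => by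
    have := DFunLike.congr_fun hsum (v, r₁, r₂)
    simpa using this
  -- The line `(0, 0, ℝ)` is tangent to the first lift and `(0, ℝ, 0)` to the second.
  have hz₁ : Φ₁ (0, 0, 1) = 0 := by
    have h1 := hΦ₁ (0, 0, 1) (hT₁ _ (hzero f₁))
    have h2 := hΦ₁ (-(0, 0, 1)) (hT₁ _ (by simpa using hzero f₁))
    rw [map_neg] at h2
    linarith
  have hz₂ : Φ₂ (0, 1, 0) = 0 := by
    have h1 := hΦ₂ (0, 1, 0) (hT₂ _ (hzero f₂))
    have h2 := hΦ₂ (-(0, 1, 0)) (hT₂ _ (by simpa using hzero f₂))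
    rw [map_neg] at h2
    linarith
  have ho₁ : Φ₁ (0, 1, 0) = -1 := by
    have := hsum' 0 1 0
    rw [hz₂, map_zero] at this
    linarith
  have ho₂ : Φ₂ (0, 0, 1) = -1 := by
    have := hsum' 0 0 1
    rw [hz₁, map_zero] at this
    linarith
  refine ⟨Φ₁.comp (ContinuousLinearMap.inl ℝ X (ℝ × ℝ)), ⟨hb₁ x₀, ht₁, ?_⟩,
    Φ₂.comp (ContinuousLinearMap.inl ℝ X (ℝ × ℝ)), ⟨hb₂ x₀, ht₂, ?_⟩, ?_⟩
  · rintro ⟨v, r⟩ hv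
    have h1 := hΦ₁ (v, r, 0) (hT₁ _ hv)
    have h2 : ((v, r, 0) : X × ℝ × ℝ) = (v, 0, 0) + r • (0, 1, 0) := by simp
    rw [h2, map_add, map_smul, ho₁] at h1
    simpa [← sub_eq_add_neg, ← Prod.mk_zero_zero] using h1
  · rintro ⟨v, r⟩ hv
    have h1 := hΦ₂ (v, 0, r) (hT₂ _ hv)
    have h2 : ((v, 0, r) : X × ℝ × ℝ) = (v, 0, 0) + r • (0, 0, 1) := by simp
    rw [h2, map_add, map_smul, ho₂] at h1
    simpa [← sub_eq_add_neg, ← Prod.mk_zero_zero] using h1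
  · ext v
    have := hsum' v 0 0
    simpa [← Prod.mk_zero_zero] using this

theorem mainTheorem3 {X : Type*} [NormedAddCommGroup X] [NormedSpace ℝ X] [CompleteSpace X] :
    (∀ (A B : Set X) (x₀ : X), IsClosed A → IsClosed B → x₀ ∈ A ∩ B →
      StronglyTangentiallyTransversal A B x₀ →
        clarkeTangentCone A x₀ ∩ clarkeTangentCone B x₀ ⊆ clarkeTangentCone (A ∩ B) x₀ ∧
        clarkeNormalCone (A ∩ B) x₀ ⊆ clarkeNormalCone A x₀ + clarkeNormalCone B x₀) ∧
    (∀ (f₁ f₂ : X → EReal) (x₀ : X),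
      LowerSemicontinuous f₁ → LowerSemicontinuous f₂ →
      (∀ x, f₁ x ≠ ⊥) → (∀ x, f₂ x ≠ ⊥) → f₁ x₀ ≠ ⊤ → f₂ x₀ ≠ ⊤ →
      StronglyTangentiallyTransversal
        {p : X × ℝ × ℝ | f₁ p.1 ≤ (p.2.1 : EReal)}
        {p : X × ℝ × ℝ | f₂ p.1 ≤ (p.2.2 : EReal)}
        (x₀, (f₁ x₀).toReal, (f₂ x₀).toReal) →
        clarkeSubdifferential (fun x => f₁ x + f₂ x) x₀ ⊆
          clarkeSubdifferential f₁ x₀ + clarkeSubdifferential f₂ x₀) := by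
  exact ⟨fun A B x₀ hA hB _ h => ⟨h.clarkeTangentCone_inter_subset hA hB,
    h.clarkeNormalCone_inter_subset hA hB⟩, fun f₁ f₂ x₀ h₁ h₂ hb₁ hb₂ ht₁ ht₂ h =>
    clarkeSubdifferential_add_subset h₁ h₂ hb₁ hb₂ ht₁ ht₂ h⟩
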